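/- Let $(M,g_M)$ be a connected smooth Riemannian manifold, let $u:M\to\mathbb R$ be smooth, and suppose that the graph $\Sigma=\{(x,u(x)):x\in M\}$ is spacelike in the Lorentzian product $(M\times\mathbb R,\ \bar g=g_M-dt^2)$. Identify $\Sigma$ with $M$ through $x\mapsto(x,u(x))$, let $g=g_M-du^2$ be the induced Riemannian metric, and let $\nu=(\nu_M,\nu_{\mathbb R})$ be the future-directed unit normal, i.e. $\bar g(\nu,\nu)=-1$, $\nu\perp T\Sigma$ and $\nu_{\mathbb R}>0$. Fix $o\in M$ and let $r_M$ and $r$ be the distances to $o$ with respect to $g_M$ and $g$. Let $G:[0,\infty)\to\mathbb R$ be continuous with (a) $G>0$, (b) $\int_0^\infty \frac{ds}{G(s)}=\infty$, (c) $G$ nondecreasing, and assume $$\nu_{\mathbb R}(x)\le G(r(x))\qquad\text{for all }x\in M .$$ Then $$g\ \ge\ g_G,\qquad\text{where } g_G:=\frac{g_M}{G(r_M)^2}.$$ If moreover $g_M$ is complete, then: 1. the (continuous) Riemannian metric $g_G$ is complete; 2. the $g_G$-distance $r_G$ to $o$ satisfies $r_G(x)=\int_0^{r_M(x)}\frac{ds}{G(s)}$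 and $r_G(x)\le r(x)\le r_M(x)$ for all $x\in M$; 3. the function $G^M(s):=G\left(\int_0^s\frac{d\rho}{G(\rho)}\right)$, $s\ge 0$, satisfies $G^M\le G$ on $[0,\infty)$, is continuous and satisfies (a), (b) and (c), and $$G^M(r_M(x))\le G(r(x))\qquad\text{for all }x\in M.$$ -/

import Mathlib

open Set Filter Topology MeasureTheory
open scoped Manifold ContDiff ENNReal Bundle

noncomputable section

namespace SpacelikeGraph

variable {E : Type*} [NormedAddCommGroup E] [NormedSpace ℝ E]
  {M : Type*} [TopologicalSpace M] [ChartedSpace E M]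

variable (E M) in
/-- A function of two tangent vectors at each point of `M`; used for fields of symmetric bilinear
forms. No regularity in the base point is built in (a conformal metric whose factor is a function
of a distance is in general only continuous). -/
abbrev FormField : Type _ :=
  ∀ x : M, TangentSpace 𝓘(ℝ, E) x → TangentSpace 𝓘(ℝ, E) x → ℝ

/-- The field of inner products of a smooth Riemannian metric on `M`. -/
def formOf [IsManifold 𝓘(ℝ, E) ∞ M]
    (gM : Bundle.ContMDiffRiemannianMetric 𝓘(ℝ, E) ∞ E
      (fun x : M => TangentSpace 𝓘(ℝ, E) x)) : FormField E M :=
  fun x v w => gM.inner x v w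

/-- The Riemannian distance of a (positive definite) field of forms `g`: the infimum of the lengths
`∫ √(g(γ', γ'))` over all `C¹` paths `γ` from `x` to `y`. -/
def metricEDist (g : FormField E M) (x y : M) : ℝ≥0∞ :=
  letI : ∀ z : M, ENorm (TangentSpace 𝓘(ℝ, E) z) :=
    fun z => ⟨fun v => ENNReal.ofReal (Real.sqrt (g z v v))⟩
  Manifold.riemannianEDist 𝓘(ℝ, E) x y

/-- The Riemannian distance of `g` as a real number (on a connected manifold it is finite). -/
def metricDist (g : FormField E M) (x y : M) : ℝ :=
  (metricEDist g x y).toReal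

/-- `g` is complete: every sequence which is Cauchy for the Riemannian distance of `g` converges
for this distance. -/
def IsCompleteMetric (g : FormField E M) : Prop :=
  ∀ s : ℕ → M,
    (∀ ε : ℝ≥0∞, 0 < ε → ∃ N : ℕ, ∀ m ≥ N, ∀ n ≥ N, metricEDist g (s m) (s n) < ε) →
    ∃ x : M, Tendsto (fun n => metricEDist g (s n) x) atTop (𝓝 0)

/-- The `M`-component of a tangent vector to `M × ℝ`. -/
def compM (p : M × ℝ) :
    TangentSpace (𝓘(ℝ, E).prod 𝓘(ℝ, ℝ)) p →L[ℝ] TangentSpace 𝓘(ℝ, E) p.1 :=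
  mfderiv (𝓘(ℝ, E).prod 𝓘(ℝ, ℝ)) 𝓘(ℝ, E) (Prod.fst : M × ℝ → M) p

/-- The `ℝ`-component of a tangent vector to `M × ℝ`, that is, the one-form `dt`. -/
def compR (p : M × ℝ) : TangentSpace (𝓘(ℝ, E).prod 𝓘(ℝ, ℝ)) p →L[ℝ] ℝ :=
  mfderiv (𝓘(ℝ, E).prod 𝓘(ℝ, ℝ)) 𝓘(ℝ, ℝ) (Prod.snd : M × ℝ → ℝ) p

/-- The Lorentzian product metric `g_M - dt²` on `M × ℝ`. -/
def lorentzProduct (gM : FormField E M) (p : M × ℝ)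
    (v w : TangentSpace (𝓘(ℝ, E).prod 𝓘(ℝ, ℝ)) p) : ℝ :=
  gM p.1 (compM p v) (compM p w) - compR p v * compR p w

/-- The parametrization `x ↦ (x, u x)` of the graph of `u`, through which the graph is identified
with `M`. -/
def graphMap (u : M → ℝ) (x : M) : M × ℝ := (x, u x)

/-- The differential of the parametrization of the graph. -/
def graphDeriv (u : M → ℝ) (x : M) :
    TangentSpace 𝓘(ℝ, E) x →L[ℝ] TangentSpace (𝓘(ℝ, E).prod 𝓘(ℝ, ℝ)) (graphMap u x) :=
  mfderiv 𝓘(ℝ, E) (𝓘(ℝ, E).prod 𝓘(ℝ, ℝ)) (graphMap u) x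

/-- The form induced on the graph of `u` by `g_M - dt²`, pulled back to `M`. -/
def inducedForm (gM : FormField E M) (u : M → ℝ) : FormField E M :=
  fun x v w => lorentzProduct gM (graphMap u x) (graphDeriv u x v) (graphDeriv u x w)

/-- The graph of `u` is spacelike: the induced form is positive definite. -/
def IsSpacelikeGraph (gM : FormField E M) (u : M → ℝ) : Prop :=
  ∀ (x : M) (v : TangentSpace 𝓘(ℝ, E) x), v ≠ 0 → 0 < inducedForm gM u x v v

/-- `ν` is the future-directed unit normal of the graph of `u` at the point over `x`: it is
orthogonal to the graph, unit timelike, and `ḡ(ν, ∂_t) = -dt(ν)` is negative. -/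
structure IsFutureUnitNormal (gM : FormField E M) (u : M → ℝ) (x : M)
    (ν : TangentSpace (𝓘(ℝ, E).prod 𝓘(ℝ, ℝ)) (graphMap u x)) : Prop where
  orthogonal : ∀ v : TangentSpace 𝓘(ℝ, E) x,
    lorentzProduct gM (graphMap u x) ν (graphDeriv u x v) = 0
  unit : lorentzProduct gM (graphMap u x) ν ν = -1
  future : 0 < compR (graphMap u x) ν

/-- The conditions on `G : [0, ∞) → ℝ` (only its values on `[0, ∞)` matter): continuous, positive,
`∫₀^∞ 1/G = ∞`, nondecreasing. -/
structure IsAdmissible (G : ℝ → ℝ) : Prop where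
  continuousOn : ContinuousOn G (Ici 0)
  pos : ∀ s, 0 ≤ s → 0 < G s
  integral_diverges : Tendsto (fun s : ℝ => ∫ t in (0 : ℝ)..s, 1 / G t) atTop atTop
  monotoneOn : MonotoneOn G (Ici 0)

/-- The conformal metric `g_M / G(r_M)²`, where `r_M` is the `g_M`-distance to `o`. -/
def conformalForm (gM : FormField E M) (G : ℝ → ℝ) (o : M) : FormField E M :=
  fun x v w => gM x v w / G (metricDist gM o x) ^ 2

/-- The function `G^M(s) = G(∫₀ˢ dr / G(r))`. -/
def boundM (G : ℝ → ℝ) (s : ℝ) : ℝ := G (∫ t in (0 : ℝ)..s, 1 / G t)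

end SpacelikeGraph

end

/-! Write `du` for the differential of `u`. Orthogonality and normalisation of `ν` give `g_M(ν_M, v)
= ν_ℝ du(v)` and `g_M(ν_M, ν_M) = ν_ℝ² - 1`. Cauchy–Schwarz then yields `ν_ℝ² du(v)² ≤ (ν_ℝ² - 1)
g_M(v, v)`, that is, `g ≥ g_M / ν_ℝ²` (`IsFutureUnitNormal.div_sq_le_inducedForm`). Since `g ≤ g_M`,
also `r ≤ r_M`, so monotonicity turns the bound `ν_ℝ ≤ G(r)` into `ν_ℝ ≤ G(r_M)`, whence `g ≥ g_G`.
At `o` the bound reads `1 ≤ ν_ℝ(o) ≤ G(0)`, so `G ≥ 1` on the half-line.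

The formula for `r_G` (`metricDist_conformalForm`) needs no minimizing geodesics. Along any path,
`r_M` changes by at most the `g_M`-length, which bounds `r_G` from below; paths that are
`g_M`-minimizing up to `ε` bound it from above. As `∫ 1/G` diverges, `g_G`-bounded sets have bounded
`r_M`, and there `g_M ≤ G(R)² g_G`, so `g_G` inherits completeness from `g_M`. Finally `G^M(r_M) =
G(r_G) ≤ G(r)`. -/

noncomputable section

namespace SpacelikeGraph

/-! ### Path lengths and distances of homogeneous forms -/

section Paths

variable {E : Type*} [NormedAddCommGroup E] [NormedSpace ℝ E]
  {M : Type*} [TopologicalSpace M] [ChartedSpace E M]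

lemma metricDist_nonneg (g : FormField E M) (x y : M) : 0 ≤ metricDist g x y :=
  ENNReal.toReal_nonneg

/-- The speed of a path with respect to a field of forms. -/
def speed (g : FormField E M) (γ : ℝ → M) (t : ℝ) : ℝ :=
  Real.sqrt (g (γ t) (mfderiv 𝓘(ℝ, ℝ) 𝓘(ℝ, E) γ t (1 : ℝ))
    (mfderiv 𝓘(ℝ, ℝ) 𝓘(ℝ, E) γ t (1 : ℝ)))

lemma speed_nonneg (g : FormField E M) (γ : ℝ → M) (t : ℝ) : 0 ≤ speed g γ t :=
  Real.sqrt_nonneg _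

/-- The length of a path with respect to a field of forms. -/
def pathLength (g : FormField E M) (γ : ℝ → M) (a b : ℝ) : ℝ≥0∞ :=
  ∫⁻ t in Icc a b, ENNReal.ofReal (speed g γ t)

/-- The associated quadratic form is homogeneous of degree two. -/
def IsHomogeneous (g : FormField E M) : Prop :=
  ∀ (x : M) (c : ℝ) (v : TangentSpace 𝓘(ℝ, E) x), g x (c • v) (c • v) = c ^ 2 * g x v v

/-- Homogeneity alone gives access to the general facts on `Manifold.riemannianEDist`; continuity of
the form in the base point plays no role. -/
lemma enormSMulClass_of_isHomogeneous {g : FormField E M} (hg : IsHomogeneous g) (x : M) :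
    letI : ENorm (TangentSpace 𝓘(ℝ, E) x) := ⟨fun v => ENNReal.ofReal (Real.sqrt (g x v v))⟩
    ENormSMulClass ℝ (TangentSpace 𝓘(ℝ, E) x) := by
  let _ : ENorm (TangentSpace 𝓘(ℝ, E) x) := ⟨fun v => ENNReal.ofReal (Real.sqrt (g x v v))⟩
  refine ⟨fun c v => ?_⟩
  change ENNReal.ofReal (Real.sqrt (g x (c • v) (c • v)))
    = ‖c‖ₑ * ENNReal.ofReal (Real.sqrt (g x v v))
  rw [hg, Real.sqrt_mul (sq_nonneg c), Real.sqrt_sq_eq_abs, ENNReal.ofReal_mul (abs_nonneg c),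
    Real.enorm_eq_ofReal_abs]

lemma metricEDist_le_pathLength {g : FormField E M} (hg : IsHomogeneous g) {γ : ℝ → M}
    (hγ : ContMDiff 𝓘(ℝ, ℝ) 𝓘(ℝ, E) 1 γ) {a b : ℝ} (hab : a ≤ b) :
    metricEDist g (γ a) (γ b) ≤ pathLength g γ a b := by
  let _ : ∀ z : M, ENorm (TangentSpace 𝓘(ℝ, E) z) :=
    fun z => ⟨fun v => ENNReal.ofReal (Real.sqrt (g z v v))⟩
  have := enormSMulClass_of_isHomogeneous hg
  refine (Manifold.riemannianEDist_le_pathELength hγ.contMDiffOn rfl rfl hab).trans_eq ?_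
  rw [Manifold.pathELength_eq_lintegral_mfderiv_Icc]
  rfl

lemma exists_pathLength_lt {g : FormField E M} (hg : IsHomogeneous g) {x y : M} {r : ℝ≥0∞}
    (h : metricEDist g x y < r) :
    ∃ γ : ℝ → M, γ 0 = x ∧ γ 1 = y ∧ ContMDiff 𝓘(ℝ, ℝ) 𝓘(ℝ, E) 1 γ ∧
      pathLength g γ 0 1 < r := by
  let _ : ∀ z : M, ENorm (TangentSpace 𝓘(ℝ, E) z) :=
    fun z => ⟨fun v => ENNReal.ofReal (Real.sqrt (g z v v))⟩
  have := enormSMulClass_of_isHomogeneous hg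
  obtain ⟨γ, h0, h1, hγ, hl, -, -⟩ :=
    Manifold.exists_lt_locally_constant_of_riemannianEDist_lt (I := 𝓘(ℝ, E)) h zero_lt_one
  refine ⟨γ, h0, h1, hγ, ?_⟩
  rw [Manifold.pathELength_eq_lintegral_mfderiv_Icc] at hl
  exact hl

lemma metricEDist_self {g : FormField E M} (hg : IsHomogeneous g) (x : M) :
    metricEDist g x x = 0 := by
  let _ : ∀ z : M, ENorm (TangentSpace 𝓘(ℝ, E) z) :=
    fun z => ⟨fun v => ENNReal.ofReal (Real.sqrt (g z v v))⟩
  have := enormSMulClass_of_isHomogeneous hg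
  exact Manifold.riemannianEDist_self

lemma metricEDist_comm {g : FormField E M} (hg : IsHomogeneous g) (x y : M) :
    metricEDist g x y = metricEDist g y x := by
  let _ : ∀ z : M, ENorm (TangentSpace 𝓘(ℝ, E) z) :=
    fun z => ⟨fun v => ENNReal.ofReal (Real.sqrt (g z v v))⟩
  have := enormSMulClass_of_isHomogeneous hg
  exact Manifold.riemannianEDist_comm

lemma metricEDist_triangle {g : FormField E M} (hg : IsHomogeneous g) (x y z : M) :
    metricEDist g x z ≤ metricEDist g x y + metricEDist g y z := by
  let _ : ∀ z : M, ENorm (TangentSpace 𝓘(ℝ, E) z) :=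
    fun z => ⟨fun v => ENNReal.ofReal (Real.sqrt (g z v v))⟩
  have := enormSMulClass_of_isHomogeneous hg
  exact Manifold.riemannianEDist_triangle

/-- A comparison of two forms on a ball gives a comparison of the distances to its center. -/
lemma metricEDist_le_mul_of_ball {g g' : FormField E M} (hg : IsHomogeneous g)
    (hg' : IsHomogeneous g') {c : ℝ} (hc : 0 ≤ c) {x y : M} {δ : ℝ≥0∞}
    (hδ : metricEDist g' x y < δ)
    (h : ∀ z, metricEDist g' x z < δ →
      ∀ v : TangentSpace 𝓘(ℝ, E) z, g z v v ≤ c ^ 2 * g' z v v) :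
    metricEDist g x y ≤ ENNReal.ofReal c * δ := by
  obtain ⟨γ, rfl, rfl, hγ, hl⟩ := exists_pathLength_lt hg' hδ
  calc metricEDist g (γ 0) (γ 1) ≤ pathLength g γ 0 1 :=
        metricEDist_le_pathLength hg hγ zero_le_one
    _ ≤ ∫⁻ t in Icc (0 : ℝ) 1, ENNReal.ofReal c * ENNReal.ofReal (speed g' γ t) := by
        refine setLIntegral_mono' measurableSet_Icc fun t ht => ?_
        rw [← ENNReal.ofReal_mul hc]
        refine ENNReal.ofReal_le_ofReal ?_
        -- A path of `g'`-length less than `δ` never leaves the `g'`-ball of radius `δ` about its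
        -- starting point, so the comparison on that ball suffices.
        have hball : metricEDist g' (γ 0) (γ t) < δ := by
          refine (metricEDist_le_pathLength hg' hγ ht.1).trans_lt (lt_of_le_of_lt ?_ hl)
          exact lintegral_mono_set (Icc_subset_Icc_right ht.2)
        refine (Real.sqrt_le_sqrt (h _ hball _)).trans_eq ?_
        rw [Real.sqrt_mul (sq_nonneg c), Real.sqrt_sq hc]
        rfl
    _ = ENNReal.ofReal c * pathLength g' γ 0 1 :=
        lintegral_const_mul' _ _ ENNReal.ofReal_ne_top
    _ ≤ ENNReal.ofReal c * δ := by gcongr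

lemma metricEDist_mono {g g' : FormField E M} (hg : IsHomogeneous g) (hg' : IsHomogeneous g')
    (h : ∀ z (v : TangentSpace 𝓘(ℝ, E) z), g z v v ≤ g' z v v) (x y : M) :
    metricEDist g x y ≤ metricEDist g' x y := by
  refine le_of_forall_gt_imp_ge_of_dense fun δ hδ => ?_
  simpa using metricEDist_le_mul_of_ball hg hg' zero_le_one hδ (fun z _ v => by simpa using h z v)

lemma pathLength_eq_ofReal_integral {g : FormField E M} {γ : ℝ → M}
    (hc : Continuous (speed g γ)) {a b : ℝ} (hab : a ≤ b) :
    pathLength g γ a b = ENNReal.ofReal (∫ t in a..b, speed g γ t) := by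
  rw [intervalIntegral.integral_of_le hab, ← integral_Icc_eq_integral_Ioc,
    ofReal_integral_eq_lintegral_ofReal (hc.continuousOn.integrableOn_Icc)
      (Eventually.of_forall fun t => speed_nonneg g γ t)]
  rfl

end Paths

/-! ### Smooth Riemannian metrics: continuous speed, finite distance -/

section Riemannian

variable {E : Type*} [NormedAddCommGroup E] [NormedSpace ℝ E]
  {M : Type*} [TopologicalSpace M] [ChartedSpace E M] [IsManifold 𝓘(ℝ, E) ∞ M]
  (gM : Bundle.ContMDiffRiemannianMetric 𝓘(ℝ, E) ∞ E (fun x : M => TangentSpace 𝓘(ℝ, E) x))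

lemma isHomogeneous_formOf : IsHomogeneous (formOf gM) := by
  intro x c v
  simp only [formOf, map_smul, smul_apply, smul_eq_mul]
  ring

lemma formOf_self_nonneg (x : M) (v : TangentSpace 𝓘(ℝ, E) x) : 0 ≤ formOf gM x v v := by
  rcases eq_or_ne v 0 with rfl | hv
  · simp [formOf]
  · exact (gM.pos x v hv).le

lemma continuous_speed_formOf {γ : ℝ → M} (hγ : ContMDiff 𝓘(ℝ, ℝ) 𝓘(ℝ, E) 1 γ) :
    Continuous (speed (formOf gM) γ) := by
  let _ : Bundle.RiemannianBundle (fun x : M => TangentSpace 𝓘(ℝ, E) x) := ⟨gM.toRiemannianMetric⟩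
  have : IsContinuousRiemannianBundle E (fun x : M => TangentSpace 𝓘(ℝ, E) x) :=
      ⟨gM.inner, gM.contMDiff.continuous, fun _ _ _ => rfl⟩
  have : IsManifold 𝓘(ℝ, E) 1 M := IsManifold.of_le (n := ∞) (by simp)
  have h1 : Continuous (tangentMap 𝓘(ℝ, ℝ) 𝓘(ℝ, E) γ) := hγ.continuous_tangentMap le_rfl
  have h2 : Continuous (fun t : ℝ => (⟨t, (1 : ℝ)⟩ : TangentBundle 𝓘(ℝ, ℝ) ℝ)) := by
    have : Continuous ((tangentBundleModelSpaceHomeomorph 𝓘(ℝ, ℝ)).symm ∘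
      fun t : ℝ => (t, (1 : ℝ))) := by fun_prop
    exact this
  have h3 := h1.comp h2
  have h4 := Continuous.inner_bundle (F := E) (E := fun x : M => TangentSpace 𝓘(ℝ, E) x)
    (b := γ) (v := fun t => mfderiv 𝓘(ℝ, ℝ) 𝓘(ℝ, E) γ t (1 : ℝ))
    (w := fun t => mfderiv 𝓘(ℝ, ℝ) 𝓘(ℝ, E) γ t (1 : ℝ)) h3 h3
  exact Real.continuous_sqrt.comp h4

/-- This identification imports the local finiteness of the distance attached to a continuous
Riemannian bundle. -/
lemma metricEDist_formOf_eq (x y : M) :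
    letI : Bundle.RiemannianBundle (fun x : M => TangentSpace 𝓘(ℝ, E) x) :=
      ⟨gM.toRiemannianMetric⟩
    metricEDist (formOf gM) x y = Manifold.riemannianEDist 𝓘(ℝ, E) x y := by
  let _ : Bundle.RiemannianBundle (fun x : M => TangentSpace 𝓘(ℝ, E) x) := ⟨gM.toRiemannianMetric⟩
  have : (fun z : M => (⟨fun v => ENNReal.ofReal (Real.sqrt (formOf gM z v v))⟩ :
      ENorm (TangentSpace 𝓘(ℝ, E) z))) = fun z =>
      (inferInstance : ENorm (TangentSpace 𝓘(ℝ, E) z)) := by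
    funext z
    congr 1
    funext v
    change _ = ‖v‖ₑ
    rw [← ofReal_norm, norm_eq_sqrt_real_inner]
    rfl
  unfold metricEDist
  congr 1

variable [ConnectedSpace M]

/-- Nearby points are at finite distance, so the set of points at finite distance from `x` is open
and closed; connectedness concludes. -/
lemma metricEDist_formOf_lt_top (x y : M) : metricEDist (formOf gM) x y < ⊤ := by
  have hom := isHomogeneous_formOf gM
  have near : ∀ z : M, ∀ᶠ w in 𝓝 z, metricEDist (formOf gM) z w < ⊤ := by
    let _ : Bundle.RiemannianBundle (fun x : M => TangentSpace 𝓘(ℝ, E) x) :=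
      ⟨gM.toRiemannianMetric⟩
    have : IsContinuousRiemannianBundle E (fun x : M => TangentSpace 𝓘(ℝ, E) x) :=
      ⟨gM.inner, gM.contMDiff.continuous, fun _ _ _ => rfl⟩
    have : IsManifold 𝓘(ℝ, E) 1 M := IsManifold.of_le (n := ∞) (by simp)
    intro z
    filter_upwards [eventually_riemannianEDist_lt 𝓘(ℝ, E) z ENNReal.zero_lt_top] with w hw
    exact (metricEDist_formOf_eq gM z w).trans_lt hw
  have hclopen : IsClopen {y | metricEDist (formOf gM) x y < ⊤} := by
    constructor
    · rw [← isOpen_compl_iff, isOpen_iff_mem_nhds]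
      intro z hz
      filter_upwards [near z] with w hw hw'
      refine hz ((metricEDist_triangle hom x w z).trans_lt (ENNReal.add_lt_top.2 ⟨hw', ?_⟩))
      rwa [metricEDist_comm hom]
    · rw [isOpen_iff_mem_nhds]
      intro z hz
      filter_upwards [near z] with w hw
      exact (metricEDist_triangle hom x z w).trans_lt (ENNReal.add_lt_top.2 ⟨hz, hw⟩)
  have : {y | metricEDist (formOf gM) x y < ⊤} = univ :=
    hclopen.eq_univ ⟨x, by simp [metricEDist_self hom]⟩
  exact this.symm.subset (mem_univ y)

/-- The distance function is controlled along a path by the integral of the speed. -/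
lemma abs_metricDist_sub_le (o : M) {γ : ℝ → M} (hγ : ContMDiff 𝓘(ℝ, ℝ) 𝓘(ℝ, E) 1 γ) {a b : ℝ}
    (hab : a ≤ b) :
    |metricDist (formOf gM) o (γ b) - metricDist (formOf gM) o (γ a)|
      ≤ ∫ t in a..b, speed (formOf gM) γ t := by
  have hom := isHomogeneous_formOf gM
  have fin := metricEDist_formOf_lt_top gM
  have hI : 0 ≤ ∫ t in a..b, speed (formOf gM) γ t :=
    intervalIntegral.integral_nonneg hab fun t _ => speed_nonneg _ _ _
  have hd : metricDist (formOf gM) (γ a) (γ b) ≤ ∫ t in a..b, speed (formOf gM) γ t := by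
    refine ENNReal.toReal_le_of_le_ofReal hI ?_
    rw [← pathLength_eq_ofReal_integral (continuous_speed_formOf gM hγ) hab]
    exact metricEDist_le_pathLength hom hγ hab
  have tri : ∀ x y z, metricDist (formOf gM) x z
      ≤ metricDist (formOf gM) x y + metricDist (formOf gM) y z := by
    intro x y z
    unfold metricDist
    rw [← ENNReal.toReal_add (fin x y).ne (fin y z).ne]
    exact ENNReal.toReal_mono (ENNReal.add_lt_top.2 ⟨fin x y, fin y z⟩).ne
      (metricEDist_triangle hom x y z)
  have t1 := tri o (γ a) (γ b)
  have t2 := tri o (γ b) (γ a)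
  have t3 : metricDist (formOf gM) (γ b) (γ a) = metricDist (formOf gM) (γ a) (γ b) := by
    unfold metricDist
    rw [metricEDist_comm hom]
  rw [abs_le]
  constructor <;> linarith

end Riemannian

end SpacelikeGraph

end

noncomputable section

namespace SpacelikeGraph

/-! ### One-variable estimates for the integral of `1 / G` -/

section RealAnalysis

variable {G : ℝ → ℝ}

lemma continuous_one_div_of_one_le (hc : Continuous G) (h1 : ∀ s, 1 ≤ G s) :
    Continuous fun t => 1 / G t :=
  continuous_const.div hc fun s => (zero_lt_one.trans_le (h1 s)).ne'

lemma integral_one_div_le_div (hc : Continuous G) (h1 : ∀ s, 1 ≤ G s) (hm : Monotone G)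
    {a b : ℝ} (hab : a ≤ b) : ∫ t in a..b, 1 / G t ≤ (b - a) / G a := by
  have hi : ∀ c d, IntervalIntegrable (fun t => 1 / G t) volume c d := fun c d =>
    (continuous_one_div_of_one_le hc h1).intervalIntegrable c d
  calc ∫ t in a..b, 1 / G t ≤ ∫ _ in a..b, 1 / G a := by
        refine intervalIntegral.integral_mono_on hab (hi _ _) intervalIntegrable_const
          fun t ht => ?_
        exact one_div_le_one_div_of_le (zero_lt_one.trans_le (h1 a)) (hm ht.1)
    _ = (b - a) / G a := by simp [div_eq_mul_inv]

lemma integral_one_div_nonneg (h1 : ∀ s, 1 ≤ G s) {a b : ℝ} (hab : a ≤ b) :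
    0 ≤ ∫ t in a..b, 1 / G t :=
  intervalIntegral.integral_nonneg hab fun t _ =>
    one_div_nonneg.2 (zero_le_one.trans (h1 t))

/-- If `b < a` the integral is nonpositive. The form with `min` allows a function `h` that is not
monotone along a path. -/
lemma integral_one_div_le_abs_div (hc : Continuous G) (h1 : ∀ s, 1 ≤ G s) (hm : Monotone G)
    (a b : ℝ) : ∫ t in a..b, 1 / G t ≤ |b - a| / G (min a b) := by
  rcases le_total a b with hab | hab
  · simpa [hab, abs_of_nonneg (sub_nonneg.2 hab)] using integral_one_div_le_div hc h1 hm hab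
  · rw [intervalIntegral.integral_symm]
    exact (neg_nonpos.2 (integral_one_div_nonneg h1 hab)).trans
      (div_nonneg (abs_nonneg _) (zero_le_one.trans (h1 _)))

/-- If `h` is dominated by the integral of `φ`, then `∫ 1 / G` over `[h a, h b]` is at most the
integral of `φ / G ∘ h`. -/
lemma integral_one_div_le_of_abs_sub_le (hc : Continuous G) (h1 : ∀ s, 1 ≤ G s)
    (hm : Monotone G) {h φ : ℝ → ℝ} (hh : Continuous h) (hφ : Continuous φ)
    (hbd : ∀ s t, s ≤ t → |h t - h s| ≤ ∫ τ in s..t, φ τ) {a b : ℝ} (hab : a ≤ b) :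
    ∫ t in (h a)..(h b), 1 / G t ≤ ∫ t in a..b, φ t / G (h t) := by
  have hpos : ∀ s, 0 < G s := fun s => zero_lt_one.trans_le (h1 s)
  have hGc := continuous_one_div_of_one_le hc h1
  have hq : Continuous fun t => φ t / G (h t) :=
    hφ.div (hc.comp hh) fun t => (hpos _).ne'
  have hprim : ∀ {f : ℝ → ℝ}, Continuous f → ∀ c x, HasDerivAt (fun y => ∫ t in c..y, f t) (f x) x :=
    fun hf c x => intervalIntegral.integral_hasDerivAt_right (hf.intervalIntegrable _ _)
      (hf.stronglyMeasurableAtFilter _ _) hf.continuousAt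
  -- Right slopes are compared instead of derivatives, because `h` (later a distance along a path)
  -- need not be differentiable.
  refine image_le_of_liminf_slope_right_le_deriv_boundary
    (f := fun y => ∫ t in (h a)..(h y), 1 / G t) (B := fun y => ∫ t in a..y, φ t / G (h t))
    (B' := fun t => φ t / G (h t)) ?_ ?_ ?_ ?_ ?_ ⟨hab, le_rfl⟩
  · have : Continuous fun y => ∫ t in (h a)..y, 1 / G t :=
      continuous_iff_continuousAt.2 fun x => (hprim hGc _ x).continuousAt
    exact (this.comp hh).continuousOn
  · simp
  · exact fun x _ => (hprim hq a x).continuousAt.continuousWithinAt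
  · exact fun x _ => (hprim hq a x).hasDerivWithinAt
  · intro x _ r hr
    refine Eventually.frequently ?_
    -- For `z` slightly to the right of `x`, the slope of the left side is at most the mean of `φ`
    -- on `[x, z]` over `G (min (h x) (h z))`, which tends to `φ x / G (h x)`.
    have hlim : Tendsto (fun z => slope (fun y => ∫ t in x..y, φ t) x z / G (min (h x) (h z)))
        (𝓝[>] x) (𝓝 (φ x / G (h x))) := by
      refine Tendsto.div ?_ ?_ (hpos _).ne'
      · exact (hasDerivAt_iff_tendsto_slope.1 (hprim hφ x x)).mono_left
          (nhdsWithin_mono _ fun z hz => ne_of_gt hz)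
      · have : Continuous fun z => G (min (h x) (h z)) := hc.comp (continuous_const.min hh)
        simpa using (this.tendsto x).mono_left nhdsWithin_le_nhds
    filter_upwards [hlim.eventually_lt_const hr, self_mem_nhdsWithin] with z hz hxz
    refine lt_of_le_of_lt ?_ hz
    have hxz' : 0 < z - x := sub_pos.2 hxz
    rw [slope_def_field, slope_def_field, div_right_comm, intervalIntegral.integral_interval_sub_left
      (hGc.intervalIntegrable _ _) (hGc.intervalIntegrable _ _)]
    gcongr
    refine (integral_one_div_le_abs_div hc h1 hm _ _).trans ?_
    have := hpos (min (h x) (h z))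
    gcongr
    simpa using hbd x z hxz.le

end RealAnalysis

/-! ### Distance and completeness of the conformal metric -/

section ConformalDistance

variable {E : Type*} [NormedAddCommGroup E] [NormedSpace ℝ E]
  {M : Type*} [TopologicalSpace M] [ChartedSpace E M] [IsManifold 𝓘(ℝ, E) ∞ M]
  (gM : Bundle.ContMDiffRiemannianMetric 𝓘(ℝ, E) ∞ E (fun x : M => TangentSpace 𝓘(ℝ, E) x))
  {G : ℝ → ℝ} (o : M)

lemma isHomogeneous_conformalForm (G : ℝ → ℝ) :
    IsHomogeneous (conformalForm (formOf gM) G o) := by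
  intro x c v
  simp only [conformalForm]
  rw [isHomogeneous_formOf gM x c v, mul_div_assoc]

lemma speed_conformalForm (h1 : ∀ s, 1 ≤ G s) (γ : ℝ → M) (t : ℝ) :
    speed (conformalForm (formOf gM) G o) γ t
      = speed (formOf gM) γ t / G (metricDist (formOf gM) o (γ t)) := by
  unfold speed conformalForm
  rw [Real.sqrt_div (formOf_self_nonneg gM _ _), Real.sqrt_sq (zero_le_one.trans (h1 _))]

variable [ConnectedSpace M]

lemma continuous_metricDist_comp {γ : ℝ → M} (hγ : ContMDiff 𝓘(ℝ, ℝ) 𝓘(ℝ, E) 1 γ) :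
    Continuous fun t => metricDist (formOf gM) o (γ t) := by
  have hφ := continuous_speed_formOf gM hγ
  have hΦ : ∀ x, Continuous fun t => ∫ τ in x..t, speed (formOf gM) γ τ := fun x =>
    intervalIntegral.continuous_primitive (fun c d => hφ.intervalIntegrable c d) x
  refine continuous_iff_continuousAt.2 fun x => ?_
  rw [ContinuousAt, tendsto_iff_dist_tendsto_zero]
  refine squeeze_zero (fun _ => dist_nonneg) (fun t => ?_)
    (show Tendsto (fun t => |∫ τ in x..t, speed (formOf gM) γ τ|) (𝓝 x) (𝓝 0) by
      simpa using ((hΦ x).abs.tendsto x))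
  rw [Real.dist_eq]
  rcases le_total x t with hxt | hxt
  · exact (abs_metricDist_sub_le gM o hγ hxt).trans (le_abs_self _)
  · rw [abs_sub_comm, intervalIntegral.integral_symm, abs_neg]
    exact (abs_metricDist_sub_le gM o hγ hxt).trans (le_abs_self _)

lemma continuous_speed_conformalForm (hc : Continuous G) (h1 : ∀ s, 1 ≤ G s) {γ : ℝ → M}
    (hγ : ContMDiff 𝓘(ℝ, ℝ) 𝓘(ℝ, E) 1 γ) :
    Continuous (speed (conformalForm (formOf gM) G o) γ) := by
  rw [funext (speed_conformalForm gM o h1 γ)]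
  exact (continuous_speed_formOf gM hγ).div (hc.comp (continuous_metricDist_comp gM o hγ))
    fun t => (zero_lt_one.trans_le (h1 _)).ne'

omit [ConnectedSpace M] in
lemma metricDist_formOf_self : metricDist (formOf gM) o o = 0 := by
  simp [metricDist, metricEDist_self (isHomogeneous_formOf gM)]

lemma ofReal_integral_le_metricEDist_conformalForm (hc : Continuous G) (h1 : ∀ s, 1 ≤ G s)
    (hm : Monotone G) (x : M) :
    ENNReal.ofReal (∫ t in (0 : ℝ)..(metricDist (formOf gM) o x), 1 / G t)
      ≤ metricEDist (conformalForm (formOf gM) G o) o x := by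
  refine le_of_forall_gt fun r hr => ?_
  obtain ⟨γ, h0, rfl, hγ, hl⟩ := exists_pathLength_lt (isHomogeneous_conformalForm gM o G) hr
  refine lt_of_le_of_lt ?_ hl
  rw [pathLength_eq_ofReal_integral (continuous_speed_conformalForm gM o hc h1 hγ) zero_le_one]
  refine ENNReal.ofReal_le_ofReal ?_
  have key := integral_one_div_le_of_abs_sub_le hc h1 hm (continuous_metricDist_comp gM o hγ)
    (continuous_speed_formOf gM hγ) (fun s t hst => abs_metricDist_sub_le gM o hγ hst)
    zero_le_one
  rw [h0, metricDist_formOf_self] at key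
  simpa only [speed_conformalForm gM o h1] using key

lemma metricEDist_conformalForm_le (hc : Continuous G) (h1 : ∀ s, 1 ≤ G s)
    (hm : Monotone G) (x : M) {ε : ℝ} (hε : 0 < ε) :
    metricEDist (conformalForm (formOf gM) G o) o x
      ≤ ENNReal.ofReal ((∫ t in (0 : ℝ)..(metricDist (formOf gM) o x), 1 / G t) + ε) := by
  have hpos : ∀ s, 0 < G s := fun s => zero_lt_one.trans_le (h1 s)
  have hGc := continuous_one_div_of_one_le hc h1
  have hGi : ∀ c d, IntervalIntegrable (fun t => 1 / G t) volume c d := fun c d =>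
    hGc.intervalIntegrable c d
  -- The path taken is `g_M`-minimizing up to `ε`.
  have hlt : metricEDist (formOf gM) o x < ENNReal.ofReal (metricDist (formOf gM) o x + ε) := by
    refine (ENNReal.lt_ofReal_iff_toReal_lt (metricEDist_formOf_lt_top gM o x).ne).2 ?_
    exact lt_add_of_pos_right _ hε
  obtain ⟨γ, rfl, rfl, hγ, hl⟩ := exists_pathLength_lt (isHomogeneous_formOf gM) hlt
  have hφ := continuous_speed_formOf gM hγ
  have hφi : ∀ c d, IntervalIntegrable (speed (formOf gM) γ) volume c d := fun c d =>
    hφ.intervalIntegrable c d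
  rw [pathLength_eq_ofReal_integral hφ zero_le_one] at hl
  have hL := (ENNReal.ofReal_lt_ofReal_iff_of_nonneg
    (intervalIntegral.integral_nonneg zero_le_one fun t _ => speed_nonneg _ _ _)).1 hl
  refine (metricEDist_le_pathLength (isHomogeneous_conformalForm gM (γ 0) G) hγ
    zero_le_one).trans ?_
  have hcs := continuous_speed_conformalForm gM (γ 0) hc h1 hγ
  rw [pathLength_eq_ofReal_integral hcs zero_le_one]
  refine ENNReal.ofReal_le_ofReal ?_
  set ℓ : ℝ → ℝ := fun t => (∫ τ in (0 : ℝ)..t, speed (formOf gM) γ τ) with hℓ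
  have hℓd : ∀ t, HasDerivAt ℓ (speed (formOf gM) γ t) t := fun t =>
    intervalIntegral.integral_hasDerivAt_right (hφi _ _)
      (hφ.stronglyMeasurableAtFilter _ _) hφ.continuousAt
  have hℓc : Continuous ℓ := continuous_iff_continuousAt.2 fun t => (hℓd t).continuousAt
  set R := metricDist (formOf gM) (γ 0) (γ 1) with hR
  have hgc : Continuous fun s => 1 / G (s - ε) := hGc.comp (continuous_id.sub continuous_const)
  calc ∫ t in (0 : ℝ)..1, speed (conformalForm (formOf gM) G (γ 0)) γ t
      ≤ ∫ t in (0 : ℝ)..1, 1 / G (ℓ t - ε) * speed (formOf gM) γ t := by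
        refine intervalIntegral.integral_mono_on zero_le_one (hcs.intervalIntegrable _ _)
          (((hgc.comp hℓc).mul hφ).intervalIntegrable _ _) fun t ht => ?_
        rw [speed_conformalForm gM _ h1, one_div_mul_eq_div]
        refine div_le_div_of_nonneg_left (speed_nonneg _ _ _) (hpos _) (hm ?_)
        -- The remaining path from `γ t` has length less than `r_M(γ 1) + ε - ℓ t`, so `r_M(γ t) ≥ ℓ
        -- t - ε`.
        have h2 := (le_abs_self _).trans (abs_metricDist_sub_le gM (γ 0) hγ ht.2)
        have h3 := intervalIntegral.integral_add_adjacent_intervals (hφi 0 t) (hφi t 1)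
        simp only [hℓ]
        linarith
    _ = ∫ s in (ℓ 0)..(ℓ 1), 1 / G (s - ε) :=
        intervalIntegral.integral_comp_mul_deriv (fun t _ => hℓd t) hφ.continuousOn hgc
    _ = ∫ s in (-ε)..(ℓ 1 - ε), 1 / G s := by
        rw [intervalIntegral.integral_comp_sub_right (fun s => 1 / G s)]
        simp [hℓ]
    _ ≤ (∫ s in (0 : ℝ)..R, 1 / G s) + ε := by
        have h4 := intervalIntegral.integral_add_adjacent_intervals (hGi (-ε) (ℓ 1 - ε))
          (hGi (ℓ 1 - ε) R)
        have h5 := intervalIntegral.integral_add_adjacent_intervals (hGi (-ε) 0) (hGi 0 R)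
        have h6 : 0 ≤ ∫ t in (ℓ 1 - ε)..R, 1 / G t :=
          integral_one_div_nonneg h1 (by simp only [hℓ]; linarith)
        -- The part of the integral over `[-ε, 0]` costs at most `ε` because `G ≥ 1` on the whole
        -- line.
        have h7 := integral_one_div_le_div hc h1 hm (neg_nonpos.2 hε.le)
        have h8 : (0 - -ε) / G (-ε) ≤ ε := by
          simpa using div_le_self hε.le (h1 (-ε))
        linarith

/-- The distance to `o` of the conformal metric `g_M / G(r_M)²`. -/
lemma metricDist_conformalForm (hc : Continuous G) (h1 : ∀ s, 1 ≤ G s) (hm : Monotone G) (x : M) :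
    metricDist (conformalForm (formOf gM) G o) o x
      = ∫ t in (0 : ℝ)..(metricDist (formOf gM) o x), 1 / G t := by
  have h0 := integral_one_div_nonneg h1
    (metricDist_nonneg (formOf gM) o x)
  refine le_antisymm (le_of_forall_pos_le_add fun ε hε => ?_) ?_
  · exact ENNReal.toReal_le_of_le_ofReal (by positivity)
      (metricEDist_conformalForm_le gM o hc h1 hm x hε)
  · refine (ENNReal.ofReal_le_iff_le_toReal ?_).1
      (ofReal_integral_le_metricEDist_conformalForm gM o hc h1 hm x)
    exact ((metricEDist_conformalForm_le gM o hc h1 hm x one_pos).trans_lt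
      ENNReal.ofReal_lt_top).ne

/-- The conformal metric `g_M / G(r_M)²` is complete if `g_M` is and `∫₀^∞ 1 / G = ∞`. -/
lemma isCompleteMetric_conformalForm (hc : Continuous G) (h1 : ∀ s, 1 ≤ G s) (hm : Monotone G)
    (hdiv : Tendsto (fun s : ℝ => ∫ t in (0 : ℝ)..s, 1 / G t) atTop atTop)
    (hcomp : IsCompleteMetric (formOf gM)) :
    IsCompleteMetric (conformalForm (formOf gM) G o) := by
  have hpos : ∀ s, 0 < G s := fun s => zero_lt_one.trans_le (h1 s)
  have hom := isHomogeneous_formOf gM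
  have hom' := isHomogeneous_conformalForm gM o G
  have hle : ∀ x y, metricEDist (conformalForm (formOf gM) G o) x y
      ≤ metricEDist (formOf gM) x y := metricEDist_mono hom' hom fun z v =>
    div_le_self (formOf_self_nonneg gM z v) (one_le_pow₀ (h1 _))
  have hfin : ∀ x y, metricEDist (conformalForm (formOf gM) G o) x y < ⊤ := fun x y =>
    (hle x y).trans_lt (metricEDist_formOf_lt_top gM x y)
  intro s hs
  obtain ⟨N, hN⟩ := hs 1 one_pos
  -- One unit covers the distance from `s N` to a later `s m`, the other the ball of radius at most
  -- `1` about `s m`.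
  obtain ⟨C, hC⟩ : ∃ C : ℝ, metricEDist (conformalForm (formOf gM) G o) o (s N) + 1 + 1
      = ENNReal.ofReal C :=
    ⟨_, (ENNReal.ofReal_toReal
      (ENNReal.add_lt_top.2 ⟨ENNReal.add_lt_top.2 ⟨hfin _ _, by simp⟩, by simp⟩).ne).symm⟩
  obtain ⟨R, hR⟩ := (hdiv.eventually_ge_atTop (max C 0)).exists
  have hbdd : ∀ z, metricEDist (conformalForm (formOf gM) G o) o z ≤ ENNReal.ofReal C →
      metricDist (formOf gM) o z ≤ R := by
    intro z hz
    by_contra! hRz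
    have h2 := integral_one_div_nonneg h1 hRz.le
    have h3 : max C 0 < ∫ t in (0 : ℝ)..metricDist (formOf gM) o z, 1 / G t := by
      have hGc := continuous_one_div_of_one_le hc h1
      rw [← intervalIntegral.integral_add_adjacent_intervals (hGc.intervalIntegrable 0 R)
        (hGc.intervalIntegrable R _)]
      have : 0 < ∫ t in R..metricDist (formOf gM) o z, 1 / G t :=
        intervalIntegral.intervalIntegral_pos_of_pos (hGc.intervalIntegrable _ _)
          (fun t => one_div_pos.2 (hpos t)) hRz
      linarith
    rw [← metricDist_conformalForm gM o hc h1 hm] at h3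
    refine absurd (ENNReal.toReal_le_of_le_ofReal (le_max_right C 0)
      (hz.trans (ENNReal.ofReal_le_ofReal (le_max_left C 0)))) (not_le.2 h3)
  have hG0 : ENNReal.ofReal (G R) ≠ 0 := (ENNReal.ofReal_pos.2 (hpos R)).ne'
  have hcauchy : ∀ ε : ℝ≥0∞, 0 < ε → ∃ K : ℕ, ∀ m ≥ K, ∀ n ≥ K,
      metricEDist (formOf gM) (s m) (s n) < ε := by
    intro ε hε
    obtain ⟨δ, hδ0, hδ⟩ : ∃ δ : ℝ≥0∞, 0 < δ ∧ ENNReal.ofReal (G R) * δ < ε := by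
      obtain ⟨ε', h0, h'⟩ := exists_between hε
      refine ⟨ε' / ENNReal.ofReal (G R), ENNReal.div_pos h0.ne' ENNReal.ofReal_ne_top, ?_⟩
      rwa [ENNReal.mul_div_cancel hG0 ENNReal.ofReal_ne_top]
    obtain ⟨K, hK⟩ := hs (min δ 1) (lt_min hδ0 one_pos)
    refine ⟨max K N, fun m hm' n hn => ?_⟩
    have hmK := (le_max_left K N).trans hm'
    refine (metricEDist_le_mul_of_ball hom hom' (hpos R).le
      (hK m hmK n ((le_max_left K N).trans hn)) fun z hz v => ?_).trans_lt
      (lt_of_le_of_lt (by gcongr; exact min_le_left δ 1) hδ)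
    have hzC : metricEDist (conformalForm (formOf gM) G o) o z ≤ ENNReal.ofReal C := by
      rw [← hC]
      refine (metricEDist_triangle hom' o (s m) z).trans (add_le_add ?_
        (hz.le.trans (min_le_right δ 1)))
      exact (metricEDist_triangle hom' o (s N) (s m)).trans (add_le_add le_rfl
        (hN N le_rfl m ((le_max_right K N).trans hm')).le)
    -- On this ball `r_M ≤ R`, hence `g_M ≤ G(R)² g_G`, and Cauchy for `g_G` becomes Cauchy for
    -- `g_M`.
    have hGle : G (metricDist (formOf gM) o z) ≤ G R := hm (hbdd z hzC)
    have hsq := pow_le_pow_left₀ (hpos (metricDist (formOf gM) o z)).le hGle 2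
    rw [conformalForm, mul_div_assoc', le_div_iff₀ (pow_pos (hpos _) 2), mul_comm]
    exact mul_le_mul_of_nonneg_right hsq (formOf_self_nonneg gM z v)
  obtain ⟨x, hx⟩ := hcomp s hcauchy
  exact ⟨x, tendsto_of_tendsto_of_tendsto_of_le_of_le tendsto_const_nhds hx
    (fun _ => zero_le) fun n => hle _ _⟩

end ConformalDistance

end SpacelikeGraph

end

noncomputable section

namespace SpacelikeGraph

/-! ### Geometry of the graph and its unit normal -/

section Graph

variable {E : Type*} [NormedAddCommGroup E] [NormedSpace ℝ E]
  {M : Type*} [TopologicalSpace M] [ChartedSpace E M] [IsManifold 𝓘(ℝ, E) ∞ M]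
  (gM : Bundle.ContMDiffRiemannianMetric 𝓘(ℝ, E) ∞ E (fun x : M => TangentSpace 𝓘(ℝ, E) x))
  {u : M → ℝ}

omit [IsManifold 𝓘(ℝ, E) ∞ M] in
lemma compM_graphDeriv {x : M} (hu : MDifferentiableAt 𝓘(ℝ, E) 𝓘(ℝ, ℝ) u x)
    (v : TangentSpace 𝓘(ℝ, E) x) :
    compM (E := E) (graphMap u x) (graphDeriv u x v) = v := by
  have hg : MDifferentiableAt 𝓘(ℝ, E) (𝓘(ℝ, E).prod 𝓘(ℝ, ℝ)) (graphMap u) x :=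
    mdifferentiableAt_id.prodMk hu
  have h := mfderiv_comp x (mdifferentiableAt_fst (I := 𝓘(ℝ, E)) (I' := 𝓘(ℝ, ℝ))) hg
  have h' : (Prod.fst : M × ℝ → M) ∘ graphMap u = id := rfl
  rw [h', mfderiv_id] at h
  exact (congrArg (fun L => L v) h).symm

/-- The term `compR (graphMap u x) (graphDeriv u x v)` plays the role of `du(v)`. -/
lemma inducedForm_self {x : M} (hu : MDifferentiableAt 𝓘(ℝ, E) 𝓘(ℝ, ℝ) u x)
    (v : TangentSpace 𝓘(ℝ, E) x) :
    inducedForm (formOf gM) u x v v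
      = formOf gM x v v - compR (E := E) (graphMap u x) (graphDeriv u x v) ^ 2 := by
  unfold inducedForm lorentzProduct
  rw [compM_graphDeriv hu, sq]
  rfl

lemma inducedForm_self_le {x : M} (hu : MDifferentiableAt 𝓘(ℝ, E) 𝓘(ℝ, ℝ) u x)
    (v : TangentSpace 𝓘(ℝ, E) x) :
    inducedForm (formOf gM) u x v v ≤ formOf gM x v v := by
  rw [inducedForm_self gM hu]
  exact sub_le_self _ (sq_nonneg _)

lemma isHomogeneous_inducedForm (hu : MDifferentiable 𝓘(ℝ, E) 𝓘(ℝ, ℝ) u) :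
    IsHomogeneous (inducedForm (formOf gM) u) := by
  intro x c v
  rw [inducedForm_self gM (hu x), inducedForm_self gM (hu x), isHomogeneous_formOf gM x c v,
    map_smul, map_smul, smul_eq_mul]
  ring

lemma formOf_mul_self_le (x : M) (v w : TangentSpace 𝓘(ℝ, E) x) :
    formOf gM x v w ^ 2 ≤ formOf gM x v v * formOf gM x w w := by
  let _ : Bundle.RiemannianBundle (fun x : M => TangentSpace 𝓘(ℝ, E) x) :=
    ⟨gM.toRiemannianMetric⟩
  rw [sq]
  exact real_inner_mul_inner_self_le (F := TangentSpace 𝓘(ℝ, E) x) v w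

lemma IsFutureUnitNormal.sq_compR {x : M}
    {ν : TangentSpace (𝓘(ℝ, E).prod 𝓘(ℝ, ℝ)) (graphMap u x)}
    (hν : IsFutureUnitNormal (formOf gM) u x ν) :
    compR (graphMap u x) ν ^ 2
      = 1 + formOf gM x (compM (graphMap u x) ν) (compM (graphMap u x) ν) := by
  have h : formOf gM x (compM (graphMap u x) ν) (compM (graphMap u x) ν)
    - compR (graphMap u x) ν * compR (graphMap u x) ν = -1 := hν.unit
  linarith

lemma IsFutureUnitNormal.one_le_compR {x : M}
    {ν : TangentSpace (𝓘(ℝ, E).prod 𝓘(ℝ, ℝ)) (graphMap u x)}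
    (hν : IsFutureUnitNormal (formOf gM) u x ν) : 1 ≤ compR (graphMap u x) ν := by
  have h := hν.sq_compR gM
  have h0 := formOf_self_nonneg gM x (compM (graphMap u x) ν)
  refine (one_le_sq_iff₀ hν.future.le).1 ?_
  linarith

/-- The induced metric is bounded below by `g_M / ν_ℝ²`. -/
lemma IsFutureUnitNormal.div_sq_le_inducedForm {x : M}
    {ν : TangentSpace (𝓘(ℝ, E).prod 𝓘(ℝ, ℝ)) (graphMap u x)}
    (hν : IsFutureUnitNormal (formOf gM) u x ν)
    (hu : MDifferentiableAt 𝓘(ℝ, E) 𝓘(ℝ, ℝ) u x) (v : TangentSpace 𝓘(ℝ, E) x) :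
    formOf gM x v v / compR (graphMap u x) ν ^ 2 ≤ inducedForm (formOf gM) u x v v := by
  have horth : formOf gM x (compM (graphMap u x) ν) v
      = compR (graphMap u x) ν * compR (E := E) (graphMap u x) (graphDeriv u x v) := by
    have h : formOf gM x (compM (graphMap u x) ν) (compM (graphMap u x) (graphDeriv u x v))
      - compR (graphMap u x) ν * compR (graphMap u x) (graphDeriv u x v) = 0 := hν.orthogonal v
    rw [compM_graphDeriv hu] at h
    exact sub_eq_zero.1 h
  -- Cauchy–Schwarz for `ν_M` and `v`; both occurrences of `ν_M` are then expressed through `ν_ℝ`.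
  have hcs := formOf_mul_self_le gM x (compM (graphMap u x) ν) v
  rw [inducedForm_self gM hu, div_le_iff₀ (pow_pos hν.future 2)]
  rw [horth] at hcs
  have hsq := hν.sq_compR gM
  have : formOf gM x (compM (graphMap u x) ν) (compM (graphMap u x) ν)
      = compR (graphMap u x) ν ^ 2 - 1 := by linarith
  rw [this] at hcs
  linarith

end Graph

/-! ### Extension of `G` to the line, and admissibility of `G^M` -/

section Admissible

variable {G : ℝ → ℝ}

/-- A function on `[0, ∞)` extended to the real line by its value at `0`. -/
def halfLineExtend (G : ℝ → ℝ) (s : ℝ) : ℝ := G (max s 0)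

lemma extend_of_nonneg (G : ℝ → ℝ) {s : ℝ} (hs : 0 ≤ s) : halfLineExtend G s = G s := by
  rw [halfLineExtend, max_eq_left hs]

lemma IsAdmissible.continuous_extend (hG : IsAdmissible G) : Continuous (halfLineExtend G) :=
  hG.continuousOn.comp_continuous (continuous_id.max continuous_const) fun s => le_max_right s 0

lemma IsAdmissible.monotone_extend (hG : IsAdmissible G) : Monotone (halfLineExtend G) := fun a b hab =>
  hG.monotoneOn (le_max_right a 0) (le_max_right b 0) (max_le_max_right 0 hab)

lemma IsAdmissible.one_le_extend (hG : IsAdmissible G) (h0 : 1 ≤ G 0) (s : ℝ) :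
    1 ≤ halfLineExtend G s :=
  h0.trans (hG.monotoneOn self_mem_Ici (le_max_right s 0) (le_max_right s 0))

lemma integral_one_div_extend (G : ℝ → ℝ) {s : ℝ} (hs : 0 ≤ s) :
    ∫ t in (0 : ℝ)..s, 1 / halfLineExtend G t = ∫ t in (0 : ℝ)..s, 1 / G t := by
  refine intervalIntegral.integral_congr fun t ht => ?_
  rw [uIcc_of_le hs] at ht
  simp only [extend_of_nonneg G ht.1]

lemma IsAdmissible.tendsto_integral_extend (hG : IsAdmissible G) :
    Tendsto (fun s : ℝ => ∫ t in (0 : ℝ)..s, 1 / halfLineExtend G t) atTop atTop :=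
  hG.integral_diverges.congr' <| by
    filter_upwards [eventually_ge_atTop 0] with s hs using (integral_one_div_extend G hs).symm

lemma IsAdmissible.integral_nonneg (hG : IsAdmissible G) {s : ℝ} (hs : 0 ≤ s) :
    0 ≤ ∫ t in (0 : ℝ)..s, 1 / G t :=
  intervalIntegral.integral_nonneg hs fun t ht => one_div_nonneg.2 (hG.pos t ht.1).le

/-- Since `G ≥ 1`, the integral `∫₀ˢ 1/G` is at most `s`, and `G` is nondecreasing. -/
lemma IsAdmissible.boundM_le (hG : IsAdmissible G) (h0 : 1 ≤ G 0) {s : ℝ} (hs : 0 ≤ s) :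
    boundM G s ≤ G s := by
  refine hG.monotoneOn (hG.integral_nonneg hs) hs ?_
  rw [← integral_one_div_extend G hs]
  refine (integral_one_div_le_div hG.continuous_extend (hG.one_le_extend h0) hG.monotone_extend
    hs).trans ?_
  simpa using div_le_self hs (hG.one_le_extend h0 0)

lemma IsAdmissible.boundM (hG : IsAdmissible G) (h0 : 1 ≤ G 0) : IsAdmissible (boundM G) := by
  have hc := continuous_one_div_of_one_le hG.continuous_extend (hG.one_le_extend h0)
  have hF : ContinuousOn (fun s => ∫ t in (0 : ℝ)..s, 1 / G t) (Ici 0) :=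
    (intervalIntegral.continuous_primitive (fun a b => hc.intervalIntegrable a b)
      0).continuousOn.congr fun s hs => (integral_one_div_extend G hs).symm
  have hcont : ContinuousOn (SpacelikeGraph.boundM G) (Ici 0) :=
    hG.continuousOn.comp hF fun s hs => hG.integral_nonneg hs
  have hpos : ∀ s, 0 ≤ s → 0 < SpacelikeGraph.boundM G s := fun s hs =>
    hG.pos _ (hG.integral_nonneg hs)
  refine ⟨hcont, hpos, ?_, ?_⟩
  -- Divergence is inherited from `G`, since `G^M ≤ G` gives `1 / G ≤ 1 / G^M`.
  · refine tendsto_atTop_mono' _ ?_ hG.integral_diverges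
    filter_upwards [eventually_ge_atTop 0] with s hs
    have hsub : uIcc 0 s ⊆ Ici (0 : ℝ) := by
      rw [uIcc_of_le hs]
      exact Icc_subset_Ici_self
    refine intervalIntegral.integral_mono_on hs ?_ ?_ fun t ht =>
      one_div_le_one_div_of_le (hpos t ht.1) (hG.boundM_le h0 ht.1)
    · exact (continuousOn_const.div (hG.continuousOn.mono hsub)
        fun t ht => (hG.pos t (hsub ht)).ne').intervalIntegrable
    · exact (continuousOn_const.div (hcont.mono hsub)
        fun t ht => (hpos t (hsub ht)).ne').intervalIntegrable
  · intro a ha b hb hab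
    refine hG.monotoneOn (hG.integral_nonneg ha) (hG.integral_nonneg hb) ?_
    rw [← integral_one_div_extend G ha, ← integral_one_div_extend G hb,
      ← intervalIntegral.integral_add_adjacent_intervals (hc.intervalIntegrable 0 a)
        (hc.intervalIntegrable a b)]
    exact le_add_of_nonneg_right (integral_one_div_nonneg (hG.one_le_extend h0) hab)

end Admissible

end SpacelikeGraph

end

open SpacelikeGraph in
theorem proposition3p10 {E : Type*} [NormedAddCommGroup E] [NormedSpace ℝ E]
    [FiniteDimensional ℝ E]
    {M : Type*} [TopologicalSpace M] [ChartedSpace E M] [IsManifold 𝓘(ℝ, E) ∞ M]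
    [T2Space M] [ConnectedSpace M]
    (gM : Bundle.ContMDiffRiemannianMetric 𝓘(ℝ, E) ∞ E
      (fun x : M => TangentSpace 𝓘(ℝ, E) x))
    (u : M → ℝ) (hu : ContMDiff 𝓘(ℝ, E) 𝓘(ℝ, ℝ) ∞ u)
    (hspace : IsSpacelikeGraph (formOf gM) u)
    (ν : ∀ x : M, TangentSpace (𝓘(ℝ, E).prod 𝓘(ℝ, ℝ)) (graphMap u x))
    (hν : ∀ x : M, IsFutureUnitNormal (formOf gM) u x (ν x))
    (o : M) (G : ℝ → ℝ) (hG : IsAdmissible G)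
    (hbound : ∀ x : M,
      compR (graphMap u x) (ν x) ≤ G (metricDist (inducedForm (formOf gM) u) o x)) :
    (∀ (x : M) (v : TangentSpace 𝓘(ℝ, E) x),
      conformalForm (formOf gM) G o x v v ≤ inducedForm (formOf gM) u x v v) ∧
    (IsCompleteMetric (formOf gM) →
      IsCompleteMetric (conformalForm (formOf gM) G o) ∧
      (∀ x : M,
        metricDist (conformalForm (formOf gM) G o) o x
            = (∫ t in (0 : ℝ)..(metricDist (formOf gM) o x), 1 / G t) ∧
        metricDist (conformalForm (formOf gM) G o) o x
            ≤ metricDist (inducedForm (formOf gM) u) o x ∧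
        metricDist (inducedForm (formOf gM) u) o x ≤ metricDist (formOf gM) o x) ∧
      (∀ s : ℝ, 0 ≤ s → boundM G s ≤ G s) ∧
      IsAdmissible (boundM G) ∧
      (∀ x : M,
        boundM G (metricDist (formOf gM) o x) ≤ G (metricDist (inducedForm (formOf gM) u) o x))) := by
  have hmd : MDifferentiable 𝓘(ℝ, E) 𝓘(ℝ, ℝ) u := hu.mdifferentiable (by simp)
  have hle : ∀ x, metricDist (inducedForm (formOf gM) u) o x ≤ metricDist (formOf gM) o x :=
    fun x => ENNReal.toReal_mono (metricEDist_formOf_lt_top gM o x).ne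
      (metricEDist_mono (isHomogeneous_inducedForm gM hmd) (isHomogeneous_formOf gM)
        (fun z v => inducedForm_self_le gM (hmd z) v) o x)
  -- The bound is evaluated at `o`, where `r = 0` and `ν_ℝ ≥ 1`.
  have h0 : 1 ≤ G 0 := by
    have h := ((hν o).one_le_compR gM).trans (hbound o)
    rwa [metricDist, metricEDist_self (isHomogeneous_inducedForm gM hmd),
      ENNReal.toReal_zero] at h
  have hform : ∀ (x : M) (v : TangentSpace 𝓘(ℝ, E) x),
      conformalForm (formOf gM) G o x v v ≤ inducedForm (formOf gM) u x v v := by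
    intro x v
    refine le_trans ?_ ((hν x).div_sq_le_inducedForm gM (hmd x) v)
    have hb : compR (graphMap u x) (ν x) ≤ G (metricDist (formOf gM) o x) :=
      (hbound x).trans
        (hG.monotoneOn (metricDist_nonneg _ _ _) (metricDist_nonneg _ _ _) (hle x))
    exact div_le_div_of_nonneg_left (formOf_self_nonneg gM x v) (pow_pos (hν x).future 2)
      (pow_le_pow_left₀ (hν x).future.le hb 2)
  -- Distances are nonnegative, so `G` may be replaced by its extension, which is continuous,
  -- monotone and at least `1` on all of `ℝ`.
  have hext : conformalForm (formOf gM) G o = conformalForm (formOf gM) (halfLineExtend G) o := by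
    funext x v w
    rw [conformalForm, conformalForm, extend_of_nonneg G (metricDist_nonneg _ _ _)]
  have hc := hG.continuous_extend
  have h1 := hG.one_le_extend h0
  have hm := hG.monotone_extend
  have hdist : ∀ x, metricDist (conformalForm (formOf gM) G o) o x
      = ∫ t in (0 : ℝ)..(metricDist (formOf gM) o x), 1 / G t := by
    intro x
    rw [hext, metricDist_conformalForm gM o hc h1 hm,
      integral_one_div_extend G (metricDist_nonneg _ _ _)]
  have hle' : ∀ x, metricDist (conformalForm (formOf gM) G o) o x
      ≤ metricDist (inducedForm (formOf gM) u) o x := by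
    intro x
    refine ENNReal.toReal_mono ?_ (metricEDist_mono (isHomogeneous_conformalForm gM o G)
      (isHomogeneous_inducedForm gM hmd) hform o x)
    -- Finiteness of `r` is needed because `toReal` sends `⊤` to `0`.
    exact ((metricEDist_mono (isHomogeneous_inducedForm gM hmd) (isHomogeneous_formOf gM)
      (fun z v => inducedForm_self_le gM (hmd z) v) o x).trans_lt
        (metricEDist_formOf_lt_top gM o x)).ne
  refine ⟨hform, fun hcomp => ⟨?_, fun x => ⟨hdist x, hle' x, hle x⟩,
    fun s hs => hG.boundM_le h0 hs, hG.boundM h0, fun x => ?_⟩⟩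
  · rw [hext]
    exact isCompleteMetric_conformalForm gM o hc h1 hm hG.tendsto_integral_extend hcomp
  -- By the distance formula, `G^M(r_M) = G(r_G)`.
  · rw [boundM, ← hdist x]
    exact hG.monotoneOn (metricDist_nonneg _ _ _) (metricDist_nonneg _ _ _) (hle' x)
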